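/- Setting. There are $m\ge 1$ sources with ages of information, sharing one channel. The $i$-th packet has service time $Y_i$, $i\ge1$, where the $Y_i$ are i.i.d. with values in a finite set $\mathcal Y\subset[0,\infty)$ and $\mathbb E[Y_1]>0$. After the $i$-th delivery (at time zero for $i=0$) a waiting time $Z_i$ from a finite set $\mathcal Z\subset[0,\infty)$ with $0\in\mathcal Z$ is imposed; then packet $i+1$ is generated and served. A (causal) sampler $f\in\mathcal F$ is a sequence $(Z_0,Z_1,\dots)$ of $\mathcal Z$-valued random variables such that $Z_i$ depends only on the information available at the $i$-th delivery; this information contains $Y_1,\dots,Y_i$, is non-decreasing in $i$, and is independent of $Y_{i+1}$. The age penalty $g:[0,\infty)\to\mathbb R$ is non-decreasing. Sources are scheduled by Maximum Age First (MAF): packet $i+1$ comes from a source of maximum age (ties broken arbitrarily), so that, starting from given initial ages $a_{l0}\ge 0$, the ages $a_{li}$ just after the $i$-th delivery satisfy $a_{l,i+1}=Y_{i+1}$ if packet $i+1$ comes from source $l$, and $a_{l,i+1}=a_{li}+Z_i+Y_{i+1}$ otherwise. Let $$\bar\Delta=\inf_{f\in\mathcal F}\limsup_{n\to\infty}\frac{\sum_{i=0}^{n-1}\mathbb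 E\big[\sum_{l=1}^m\int_{a_{li}}^{a_{li}+Z_i+Y_{i+1}}g(\tau)\,d\tau\big]}{\sum_{i=0}^{n-1}\mathbb E[Z_i+Y_{i+1}]}$$ be the optimal total-average age penalty per unit time. Consider the following Markov decision process. States are vectors $\mathbf s=(a_{[1]},\dots,a_{[m]})$ of ages in decreasing order. The action $z\in\mathcal Z$ and the service time $y\in\mathcal Y$ lead from $\mathbf s$ to $\mathbf s'$ with $a'_{[m]}=y$ and $a'_{[l]}=a_{[l+1]}+z+y$ for $l<m$; $\mathbb P_{\mathbf s\mathbf s'}(z)$ is the resulting transition probability when $y$ is distributed as $Y_1$. The state space $\mathcal S$ is the (finite) set of all vectors that can be reached in this way from the sorted vector of initial ages, which is included. The cost per stage is $$C(\mathbf s,z)=\mathbb E\Big[\sum_{l=1}^m\int_{a_{[l]}}^{a_{[l]}+z+Y_1}g(\tau)\,d\tau-\bar\Delta\,(z+Y_1)\Big].$$ For $f\in\mathcal F$ and $\mathbf s(0)=\mathbf s\in\mathcal S$ let $\mathbf s(i)$ be the state process; the average cost of $f$ is $\limsup_{n\to\infty}\frac1n\mathbb E[\sum_{i=0}^{n-1}C(\mathbf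 s(i),Z_i)]$, and $f$ is average-optimal if it minimizes this over $\mathcal F$. For $0<\alpha<1$ let $J_\alpha(\mathbf s)=\min_{f\in\mathcal F}\limsup_{n\to\infty}\mathbb E[\sum_{i=0}^{n-1}\alpha^iC(\mathbf s(i),Z_i)]$. Proposition. The minimum defining $J_\alpha(\mathbf s)$ is attained for all $0<\alpha<1$ and $\mathbf s\in\mathcal S$. There is a scalar $\lambda$ such that, for every initial state $\mathbf s\in\mathcal S$, $\lambda$ is the minimum over $f\in\mathcal F$ of the average cost from $\mathbf s$, and $\lambda=\lim_{\alpha\uparrow1}(1-\alpha)J_\alpha(\mathbf s)$. Moreover, for every reference state $\mathbf o\in\mathcal S$ there is a function $h$ such that $h(\mathbf s)=\lim_{\alpha\uparrow1}\big(J_\alpha(\mathbf s)-J_\alpha(\mathbf o)\big)$ and $$\lambda+h(\mathbf s)=\min_{z\in\mathcal Z}\Big(C(\mathbf s,z)+\sum_{\mathbf s'\in\mathcal S}\mathbb P_{\mathbf s\mathbf s'}(z)\,h(\mathbf s')\Big)\qquad\text{for all }\mathbf s\in\mathcal S,$$ and there is a stationary deterministic policy $Z_i=q(\mathbf s(i))$,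 where $q$ maps into $\mathcal Z$ and $q(\mathbf s)$ attains this minimum for each $\mathbf s\in\mathcal S$, that is average-optimal from every initial state in $\mathcal S$. -/

import Mathlib

open MeasureTheory ProbabilityTheory Filter Topology

noncomputable section

namespace AgeSampling

/-- A status update system with `m` sources that share one channel and are served by the Maximum
Age First (MAF) scheduler. Only `Y 1, Y 2, …` matter: `Y i` is the service time of packet `i`
(there is no packet `0`). `info i` is the information available to the decision maker at the
delivery time of packet `i` (time zero for `i = 0`): it contains all past service times, possibly
also independent randomization, and is independent of the next service time. -/
structure MAFSystem {Ω : Type*} [mΩ : MeasurableSpace Ω] (P : Measure Ω) (m : ℕ) where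
  /-- the age-penalty function (only its values on `[0, ∞)` are used) -/
  g : ℝ → ℝ
  g_mono : MonotoneOn g (Set.Ici 0)
  /-- the finite set of admissible waiting times -/
  waits : Finset ℝ
  zero_mem_waits : (0 : ℝ) ∈ waits
  waits_nonneg : ∀ z ∈ waits, 0 ≤ z
  /-- the finite set of possible service times -/
  services : Finset ℝ
  services_nonneg : ∀ y ∈ services, 0 ≤ y
  /-- the service times -/
  Y : ℕ → Ω → ℝ
  Y_mem : ∀ i ω, Y (i + 1) ω ∈ services
  Y_ident : ∀ i, IdentDistrib (Y (i + 1)) (Y 1) P P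
  Y_mean_pos : 0 < ∫ ω, Y 1 ω ∂P
  /-- the information available at the successive delivery times -/
  info : Filtration ℕ mΩ
  Y_adapted : ∀ i, Measurable[info (i + 1)] (Y (i + 1))
  Y_indep : ∀ i, Indep (MeasurableSpace.comap (Y (i + 1)) inferInstance) (info i) P
  /-- the initial ages of the sources -/
  initAge : Fin m → ℝ
  initAge_nonneg : ∀ l, 0 ≤ initAge l
  /-- the MAF scheduler: a source of maximum age, ties being broken arbitrarily -/
  maf : (Fin m → ℝ) → Fin m
  maf_max : ∀ (a : Fin m → ℝ) (l : Fin m), a l ≤ a (maf a)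

variable {Ω : Type*} [mΩ : MeasurableSpace Ω] {P : Measure Ω} {m : ℕ}

/-- The next state when the waiting time `z` is followed by the service time `y`. States list the
ages in decreasing order, so that index `0` is the largest and index `m - 1` the smallest age. -/
def nextState (s : Fin m → ℝ) (z y : ℝ) : Fin m → ℝ := fun l =>
  if h : (l : ℕ) + 1 < m then s ⟨(l : ℕ) + 1, h⟩ + z + y else y

/-- The components of a vector in decreasing order. -/
def sortDesc (a : Fin m → ℝ) : Fin m → ℝ := fun l => a (Tuple.sort a l.rev)

namespace MAFSystem

variable (M : MAFSystem P m)

/-- A causal sampler: the waiting time `Z i`, chosen after the delivery of packet `i`, is admissible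
and depends only on the information available at that time. -/
structure Sampler where
  Z : ℕ → Ω → ℝ
  Z_mem : ∀ i ω, Z i ω ∈ M.waits
  Z_adapted : ∀ i, Measurable[M.info i] (Z i)

/-- `M.age f i ω l` is the age of source `l` just after the delivery of packet `i` (at time zero if
`i = 0`), under the MAF scheduler and the sampler `f`. -/
def age (f : M.Sampler) : ℕ → Ω → Fin m → ℝ
  | 0, _ => M.initAge
  | i + 1, ω => fun l =>
      if l = M.maf (age f i ω) then M.Y (i + 1) ω
      else age f i ω l + f.Z i ω + M.Y (i + 1) ω

/-- The total age penalty accumulated over a stage that starts with ages `a` and consists of the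
waiting time `z` and the service time `y`. -/
def penalty (a : Fin m → ℝ) (z y : ℝ) : ℝ :=
  ∑ l, ∫ τ in (a l)..(a l + z + y), M.g τ

/-- The total-average age penalty per unit time (Ta-AP) of the sampler `f` under the MAF
scheduler. -/
def taAP (f : M.Sampler) : ℝ :=
  limsup (fun n : ℕ =>
    (∑ i ∈ Finset.range n, ∫ ω, M.penalty (M.age f i ω) (f.Z i ω) (M.Y (i + 1) ω) ∂P) /
      (∑ i ∈ Finset.range n, ∫ ω, (f.Z i ω + M.Y (i + 1) ω) ∂P)) atTop

/-- The optimal Ta-AP under the MAF scheduler. -/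
def optTaAP : ℝ := ⨅ f : M.Sampler, M.taAP f

/-- The states of the decision process: those reachable from the sorted initial ages. -/
inductive Reachable : (Fin m → ℝ) → Prop
  | init : Reachable (sortDesc M.initAge)
  | step {s : Fin m → ℝ} {z y : ℝ} (hs : Reachable s) (hz : z ∈ M.waits) (hy : y ∈ M.services) :
      Reachable (nextState s z y)

/-- Values that a component may take, by the number of stages that it has aged (auxiliary). -/
def ageValues : ℕ → Set ℝ
  | 0 => Set.range (sortDesc M.initAge) ∪ (M.services : Set ℝ)
  | k + 1 => ageValues k ∪
      (fun p : ℝ × ℝ × ℝ => p.1 + p.2.1 + p.2.2) '' (ageValues k ×ˢ (M.waits : Set ℝ) ×ˢ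
        (M.services : Set ℝ))

theorem ageValues_finite (k : ℕ) : (M.ageValues k).Finite := by
  induction k with
  | zero => exact (Set.finite_range _).union (Finset.finite_toSet _)
  | succ k ih =>
    exact ih.union ((ih.prod ((Finset.finite_toSet _).prod (Finset.finite_toSet _))).image _)

theorem ageValues_zero_subset (k : ℕ) : M.ageValues 0 ⊆ M.ageValues k := by
  induction k with
  | zero => exact subset_rfl
  | succ k ih => exact ih.trans Set.subset_union_left

/-- There are finitely many states. -/
theorem finite_reachable : {s | M.Reachable s}.Finite := by
  refine (Set.Finite.pi' (fun l : Fin m => M.ageValues_finite (m - 1 - l))).subset ?_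
  intro s hs
  have hs' : M.Reachable s := hs
  clear hs
  induction hs' with
  | init =>
    intro l
    exact M.ageValues_zero_subset _ (Or.inl ⟨l, rfl⟩)
  | @step s z y _ hz hy ih =>
    intro l
    by_cases h : (l : ℕ) + 1 < m
    · have e : m - 1 - (l : ℕ) = (m - 1 - ((l : ℕ) + 1)) + 1 := by omega
      rw [e]
      refine Or.inr ⟨(s ⟨(l : ℕ) + 1, h⟩, z, y), ⟨ih ⟨(l : ℕ) + 1, h⟩, hz, hy⟩, ?_⟩
      simp [nextState, h]
    · simp only [nextState, h, dite_false]
      exact M.ageValues_zero_subset _ (Or.inr hy)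

/-- The finite state space. -/
def states : Finset (Fin m → ℝ) := M.finite_reachable.toFinset

/-- The probability of moving from `s` to `s'` under the waiting time `z`. -/
def transProb (s : Fin m → ℝ) (z : ℝ) (s' : Fin m → ℝ) : ℝ :=
  P.real {ω | nextState s z (M.Y 1 ω) = s'}

/-- The expected cost of a stage that starts in `s` with the waiting time `z`. -/
def cost (s : Fin m → ℝ) (z : ℝ) : ℝ :=
  ∫ ω, (M.penalty s z (M.Y 1 ω) - M.optTaAP * (z + M.Y 1 ω)) ∂P

/-- The state process started in `s` and controlled by the sampler `f`. -/
def state (s : Fin m → ℝ) (f : M.Sampler) : ℕ → Ω → Fin m → ℝ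
  | 0, _ => s
  | i + 1, ω => nextState (state s f i ω) (f.Z i ω) (M.Y (i + 1) ω)

/-- The average cost per stage of `f` from the initial state `s`. -/
def avgCost (s : Fin m → ℝ) (f : M.Sampler) : ℝ :=
  limsup (fun n : ℕ =>
    (1 / (n : ℝ)) * ∫ ω, ∑ i ∈ Finset.range n, M.cost (M.state s f i ω) (f.Z i ω) ∂P) atTop

/-- The total expected `α`-discounted cost of `f` from the initial state `s`. -/
def discCost (α : ℝ) (s : Fin m → ℝ) (f : M.Sampler) : ℝ :=
  limsup (fun n : ℕ =>
    ∫ ω, ∑ i ∈ Finset.range n, α ^ i * M.cost (M.state s f i ω) (f.Z i ω) ∂P) atTop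

/-- The optimal total expected `α`-discounted cost. -/
def optDiscCost (α : ℝ) (s : Fin m → ℝ) : ℝ := ⨅ f : M.Sampler, M.discCost α s f

/-- The quantity that is minimized over the waiting time `z` in Bellman's equation. -/
def bellmanRHS (h : (Fin m → ℝ) → ℝ) (s : Fin m → ℝ) (z : ℝ) : ℝ :=
  M.cost s z + ∑ s' ∈ M.states, M.transProb s z s' * h s'

/-- `f` is average-optimal from the initial state `s`. -/
def IsAverageOptimal (s : Fin m → ℝ) (f : M.Sampler) : Prop :=
  ∀ f' : M.Sampler, M.avgCost s f ≤ M.avgCost s f'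

/-- From the initial state `s`, the sampler `f` is the stationary deterministic policy `q`. -/
def IsStationary (q : (Fin m → ℝ) → ℝ) (s : Fin m → ℝ) (f : M.Sampler) : Prop :=
  ∀ i ω, f.Z i ω = q (M.state s f i ω)

end MAFSystem

end AgeSampling

end

/-!
The decision process is finite, and its transitions are driven by the service times: the next state
is a deterministic function of the state, the waiting time and the service time, which is
independent of all information used so far. Only two features of the sampling problem matter. The
cost per stage is a function on a finite set, whatever the value of the scalar `optTaAP` in it; and
the process forgets its initial state, because every stage shifts the vector of ages by one place
and fills in the new service time, so that after `m` stages with common waiting and service times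
the state no longer depends on where the process started.

*Discounted problem.* For `α < 1` every stationary policy `q` has a cost
`(1 - α P_q)⁻¹ c_q`, a rational function of `α`, and a policy that minimizes the sum of these costs
over the initial states solves Bellman's equation (`NoiseMDP.exists_isBellman`). Verification
against arbitrary causal samplers (`Sampler.le_sum_stageCost`) rests on the one-step identity
`Sampler.integral_stateProc_succ`, and identifies the solution with `optDiscCost`
(`isLeast_discCost`).

*Vanishing discount.* By forgetting, the discounted costs from two states differ by at most the cost
of `m` stages, uniformly in `α` (`NoiseMDP.IsBellman.sub_le`). Boundedness alone gives limits only
along subsequences, and solutions of the average-cost equation need not be unique up to constants.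
Full limits exist because the optimal discounted cost is a minimum of finitely many rational
functions, hence itself rational near `1` (`NoiseMDP.rationalNearOne_of_isBellman`), and a bounded
rational function converges (`RationalNearOne.exists_tendsto`). Passing to the limit in the
discounted equation gives the average-cost equation (`NoiseMDP.exists_vanishing_discount`).

*Average cost.* A solution of the average-cost equation bounds the average cost of every sampler
from below (`le_avgCost`), with equality for feedback by minimizers (`avgCost_eq_of_feedback`).
-/

noncomputable section
namespace AgeSampling

/-! ### Functions that are rational to the left of `1` -/

/-- `u` agrees with a quotient of two polynomials on a left neighbourhood of `1`. The equation is
cleared of the denominator, which has only finitely many roots. -/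
def RationalNearOne (u : ℝ → ℝ) : Prop :=
  ∃ N D : Polynomial ℝ, D ≠ 0 ∧ ∀ᶠ x in 𝓝[<] (1 : ℝ), D.eval x * u x = N.eval x

theorem eventually_eval_ne_zero {D : Polynomial ℝ} (hD : D ≠ 0) :
    ∀ᶠ x in 𝓝[<] (1 : ℝ), D.eval x ≠ 0 := by
  have h1 : ∀ᶠ x in 𝓝[≠] (1 : ℝ), D.eval x ≠ 0 := by
    have hfin : ({x | D.IsRoot x} : Set ℝ).Finite := Polynomial.finite_setOfPred_isRoot hD
    have := (hfin.subset (Set.sep_subset _ (fun x => x ≠ 1))).isClosed.isOpen_compl.mem_nhds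
      (x := (1 : ℝ)) (by simp)
    filter_upwards [nhdsWithin_le_nhds this, self_mem_nhdsWithin] with x hx hx1 h0
    exact hx ⟨h0, hx1⟩
  exact nhdsWithin_mono _ (fun x hx => ne_of_lt hx) h1

theorem eventually_eval_nonneg_or_nonpos (F : Polynomial ℝ) :
    (∀ᶠ x in 𝓝[<] (1 : ℝ), 0 ≤ F.eval x) ∨ ∀ᶠ x in 𝓝[<] (1 : ℝ), F.eval x ≤ 0 := by
  rcases eq_or_ne F 0 with rfl | hF
  · simp
  obtain ⟨a, ha, hne⟩ := mem_nhdsLT_iff_exists_Ioo_subset.1 (eventually_eval_ne_zero hF)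
  have hIoo : Set.Ioo a 1 ∈ 𝓝[<] (1 : ℝ) := Ioo_mem_nhdsLT ha
  by_contra! hcon
  obtain ⟨h1, h2⟩ := hcon
  obtain ⟨x, hx, hxI⟩ := (h1.and_eventually hIoo).exists
  obtain ⟨y, hy, hyI⟩ := (h2.and_eventually hIoo).exists
  obtain ⟨z, hz, hz0⟩ := isPreconnected_Ioo.intermediate_value hxI hyI
    F.continuous.continuousOn (Set.mem_Icc.2 ⟨hx.le, hy.le⟩)
  exact hne hz hz0

namespace RationalNearOne

theorem congr {u v : ℝ → ℝ} (hu : RationalNearOne u) (h : u =ᶠ[𝓝[<] 1] v) :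
    RationalNearOne v := by
  obtain ⟨N, D, hD, hND⟩ := hu
  refine ⟨N, D, hD, ?_⟩
  filter_upwards [hND, h] with x hx hx'
  rw [← hx', hx]

theorem sub {u v : ℝ → ℝ} (hu : RationalNearOne u) (hv : RationalNearOne v) :
    RationalNearOne fun x => u x - v x := by
  obtain ⟨N, D, hD, hND⟩ := hu
  obtain ⟨N', D', hD', hND'⟩ := hv
  refine ⟨N * D' - N' * D, D * D', mul_ne_zero hD hD', ?_⟩
  filter_upwards [hND, hND'] with x hx hx'
  simp only [Polynomial.eval_mul, Polynomial.eval_sub, ← hx, ← hx']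
  ring

theorem eval_mul (F : Polynomial ℝ) {u : ℝ → ℝ} (hu : RationalNearOne u) :
    RationalNearOne fun x => F.eval x * u x := by
  obtain ⟨N, D, hD, hND⟩ := hu
  refine ⟨F * N, D, hD, ?_⟩
  filter_upwards [hND] with x hx
  simp only [Polynomial.eval_mul, ← hx]
  ring

theorem const (a : ℝ) : RationalNearOne fun _ => a :=
  ⟨Polynomial.C a, 1, one_ne_zero, by simp⟩

theorem eventually_nonneg_or_nonpos {u : ℝ → ℝ} (hu : RationalNearOne u) :
    (∀ᶠ x in 𝓝[<] (1 : ℝ), 0 ≤ u x) ∨ ∀ᶠ x in 𝓝[<] (1 : ℝ), u x ≤ 0 := by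
  obtain ⟨N, D, hD, hND⟩ := hu
  have key : ∀ᶠ x in 𝓝[<] (1 : ℝ), 0 < D.eval x ^ 2 ∧ (D * N).eval x = D.eval x ^ 2 * u x := by
    filter_upwards [hND, eventually_eval_ne_zero hD] with x hx hx0
    refine ⟨by positivity, ?_⟩
    rw [Polynomial.eval_mul, ← hx]
    ring
  refine (eventually_eval_nonneg_or_nonpos (D * N)).imp (fun h => ?_) (fun h => ?_)
  · filter_upwards [key, h] with x hx h0
    exact nonneg_of_mul_nonneg_right (hx.2 ▸ h0) hx.1
  · filter_upwards [key, h] with x hx h0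
    exact nonpos_of_mul_nonpos_right (hx.2 ▸ h0) hx.1

/-- A bounded function that is rational near `1` cannot oscillate: its difference to every constant
has an eventual sign. -/
theorem exists_tendsto {u : ℝ → ℝ} (hu : RationalNearOne u) {K : ℝ}
    (hK : ∀ᶠ x in 𝓝[<] (1 : ℝ), |u x| ≤ K) : ∃ L, Tendsto u (𝓝[<] 1) (𝓝 L) := by
  refine tendsto_of_no_upcrossings dense_univ ?_
    ⟨K, hK.mono fun x hx => (abs_le.1 hx).2⟩ ⟨-K, hK.mono fun x hx => (abs_le.1 hx).1⟩
  rintro a - b - hab ⟨h1, h2⟩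
  rcases (hu.sub (const a)).eventually_nonneg_or_nonpos with h | h
  · obtain ⟨x, hx, hx'⟩ := (h1.and_eventually h).exists
    linarith
  · obtain ⟨x, hx, hx'⟩ := (h2.and_eventually h).exists
    linarith

theorem exists_eventually_le {ι : Type*} [Finite ι] [Nonempty ι] {u : ι → ℝ → ℝ}
    (hu : ∀ i, RationalNearOne (u i)) :
    ∃ i, ∀ᶠ x in 𝓝[<] (1 : ℝ), ∀ j, u i x ≤ u j x := by
  let r : ι → ι → Prop := fun j i => ∀ᶠ x in 𝓝[<] (1 : ℝ), u i x ≤ u j x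
  have : IsTrans ι r := ⟨fun i j k h h' => by
    filter_upwards [h, h'] with x hx hx' using hx'.trans hx⟩
  have hdir : Directed r (id : ι → ι) := by
    intro i j
    rcases ((hu i).sub (hu j)).eventually_nonneg_or_nonpos with h | h
    · exact ⟨j, h.mono fun x hx => by simpa using hx, Eventually.of_forall fun x => le_rfl⟩
    · exact ⟨i, Eventually.of_forall fun x => le_rfl, h.mono fun x hx => by simpa using hx⟩
  obtain ⟨i, hi⟩ := hdir.finite_le (id : ι → ι)
  exact ⟨i, eventually_all.2 hi⟩

end RationalNearOne

/-! ### Finite Markov decision processes -/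

/-- A Markov decision process whose transitions are driven by independent noise: in state `s`, the
action `a` and the noise value `b`, which has probability `prob b`, lead to `next s a b`. -/
structure NoiseMDP (S A B : Type*) [Fintype B] where
  next : S → A → B → S
  prob : B → ℝ
  prob_nonneg : ∀ b, 0 ≤ prob b
  prob_sum : ∑ b, prob b = 1
  cost : S → A → ℝ

namespace NoiseMDP

variable {S A B : Type*} [Fintype B] (D : NoiseMDP S A B)

/-- The expectation of `V` at the next state. -/
def expNext (V : S → ℝ) (s : S) (a : A) : ℝ := ∑ b, D.prob b * V (D.next s a b)

/-- The cost of the action `a` in `s`, followed by the `α`-discounted continuation cost `V`. -/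
def actionValue (α : ℝ) (V : S → ℝ) (s : S) (a : A) : ℝ := D.cost s a + α * D.expNext V s a

/-- Bellman's equation `lam + V s = min_a (cost s a + α * E V(next))`. The discounted equation has
`lam = 0` and `α < 1`, the average-cost equation has `α = 1`. -/
structure IsBellman (α lam : ℝ) (V : S → ℝ) : Prop where
  le : ∀ s a, lam + V s ≤ D.actionValue α V s a
  exists_eq : ∀ s, ∃ a, lam + V s = D.actionValue α V s a

theorem expNext_sub (V W : S → ℝ) (s : S) (a : A) :
    D.expNext (fun t => V t - W t) s a = D.expNext V s a - D.expNext W s a := by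
  simp [expNext, mul_sub, Finset.sum_sub_distrib]

theorem expNext_const (k : ℝ) (s : S) (a : A) : D.expNext (fun _ => k) s a = k := by
  simp [expNext, ← Finset.sum_mul, D.prob_sum]

theorem expNext_le {V : S → ℝ} {k : ℝ} {s : S} {a : A} (h : ∀ b, V (D.next s a b) ≤ k) :
    D.expNext V s a ≤ k := by
  calc D.expNext V s a ≤ ∑ b, D.prob b * k :=
        Finset.sum_le_sum fun b _ => mul_le_mul_of_nonneg_left (h b) (D.prob_nonneg b)
    _ = k := by rw [← Finset.sum_mul, D.prob_sum, one_mul]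

theorem le_expNext {V : S → ℝ} {k : ℝ} {s : S} {a : A} (h : ∀ b, k ≤ V (D.next s a b)) :
    k ≤ D.expNext V s a := by
  calc k = ∑ b, D.prob b * k := by rw [← Finset.sum_mul, D.prob_sum, one_mul]
    _ ≤ D.expNext V s a :=
        Finset.sum_le_sum fun b _ => mul_le_mul_of_nonneg_left (h b) (D.prob_nonneg b)

variable {α : ℝ}

/-- Maximum principle for the discounted transition operator of a policy. -/
theorem nonpos_of_le_expNext [Finite S] (hα : 0 < α) (hα1 : α < 1) (q : S → A) {V : S → ℝ}
    (h : ∀ s, V s ≤ α * D.expNext V s (q s)) (s : S) : V s ≤ 0 := by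
  have : Nonempty S := ⟨s⟩
  obtain ⟨t, ht⟩ := Finite.exists_max V
  have h1 : V t ≤ α * V t := (h t).trans <|
    mul_le_mul_of_nonneg_left (D.expNext_le fun b => ht _) hα.le
  have : V t ≤ 0 := by nlinarith
  exact (ht s).trans this

/-! ### Stationary policies in the discounted problem -/

section Policy

variable [Fintype S] [DecidableEq S]

/-- The transition matrix of the stationary policy `q`. -/
def transMatrix (q : S → A) : Matrix S S ℝ :=
  fun s s' => ∑ b, D.prob b * if D.next s (q s) b = s' then 1 else 0

theorem transMatrix_mulVec (q : S → A) (V : S → ℝ) (s : S) :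
    (D.transMatrix q).mulVec V s = D.expNext V s (q s) := by
  simp only [Matrix.mulVec, dotProduct, transMatrix, expNext, Finset.sum_mul, mul_assoc]
  rw [Finset.sum_comm]
  refine Finset.sum_congr rfl fun b _ => ?_
  simp

/-- The matrix `1 - α P` of the policy `q`, as a matrix of polynomials in `α`. -/
def resolventPoly (q : S → A) : Matrix S S (Polynomial ℝ) :=
  1 - (Polynomial.X : Polynomial ℝ) • (D.transMatrix q).map Polynomial.C

theorem map_resolventPoly (q : S → A) (α : ℝ) :
    (Polynomial.evalRingHom α).mapMatrix (D.resolventPoly q) = 1 - α • D.transMatrix q := by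
  ext s s'
  by_cases h : s = s' <;> simp [resolventPoly, h, mul_comm α]

theorem eval_det_resolventPoly (q : S → A) (α : ℝ) :
    (D.resolventPoly q).det.eval α = (1 - α • D.transMatrix q).det := by
  rw [← map_resolventPoly, ← RingHom.map_det, Polynomial.coe_evalRingHom]

theorem resolvent_mulVec (q : S → A) (α : ℝ) (V : S → ℝ) (s : S) :
    (1 - α • D.transMatrix q).mulVec V s = V s - α * D.expNext V s (q s) := by
  rw [Matrix.sub_mulVec, Matrix.one_mulVec, Matrix.smul_mulVec, Pi.sub_apply, Pi.smul_apply,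
    transMatrix_mulVec, smul_eq_mul]

theorem det_resolvent_ne_zero (hα : 0 < α) (hα1 : α < 1) (q : S → A) :
    (1 - α • D.transMatrix q).det ≠ 0 := by
  intro h0
  obtain ⟨v, hv, hv0⟩ := Matrix.exists_mulVec_eq_zero_iff.2 h0
  have hv1 : ∀ s, v s = α * D.expNext v s (q s) := fun s => by
    have := congrFun hv0 s
    rw [resolvent_mulVec, Pi.zero_apply] at this
    linarith
  apply hv
  funext s
  refine le_antisymm (D.nonpos_of_le_expNext hα hα1 q (fun s => (hv1 s).le) s) ?_
  have := D.nonpos_of_le_expNext hα hα1 q (V := fun s => 0 - v s) (fun s => by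
    have h2 := D.expNext_sub (fun _ => 0) v s (q s)
    rw [D.expNext_const] at h2
    rw [h2, hv1 s]
    linarith) s
  simpa using this

/-- The discounted cost of the stationary policy `q`, as the solution of `(1 - α P) V = cost` given
by Cramer's rule. -/
def policyValue (q : S → A) (α : ℝ) : S → ℝ := fun s =>
  (1 - α • D.transMatrix q).det⁻¹ *
    ((1 - α • D.transMatrix q).adjugate.mulVec fun t => D.cost t (q t)) s

theorem policyValue_eq (hα : 0 < α) (hα1 : α < 1) (q : S → A) (s : S) :
    D.policyValue q α s = D.actionValue α (D.policyValue q α) s (q s) := by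
  have h0 := D.det_resolvent_ne_zero hα hα1 q
  have h1 := D.resolvent_mulVec q α (D.policyValue q α) s
  have h2 : D.policyValue q α = (1 - α • D.transMatrix q).det⁻¹ •
      ((1 - α • D.transMatrix q).adjugate.mulVec fun t => D.cost t (q t)) := rfl
  rw [h2, Matrix.mulVec_smul, Matrix.mulVec_mulVec, Matrix.mul_adjugate, Matrix.smul_mulVec,
    Matrix.one_mulVec, smul_smul, inv_mul_cancel₀ h0, one_smul, ← h2] at h1
  rw [actionValue, h1]
  ring

theorem rationalNearOne_policyValue (q : S → A) (s : S) :
    RationalNearOne fun α => D.policyValue q α s := by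
  have hne : ∀ᶠ α in 𝓝[<] (1 : ℝ), (1 - α • D.transMatrix q).det ≠ 0 := by
    filter_upwards [Ioo_mem_nhdsLT (zero_lt_one' ℝ)] with α hα
    exact D.det_resolvent_ne_zero hα.1 hα.2 q
  refine ⟨∑ t, (D.resolventPoly q).adjugate s t * Polynomial.C (D.cost t (q t)),
    (D.resolventPoly q).det, ?_, ?_⟩
  · intro h0
    obtain ⟨α, hα⟩ := hne.exists
    rw [← eval_det_resolventPoly, h0] at hα
    simp at hα
  · filter_upwards [hne] with α hα
    rw [eval_det_resolventPoly, policyValue, mul_inv_cancel_left₀ hα, ← map_resolventPoly,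
      ← RingHom.map_adjugate, Polynomial.eval_finsetSum]
    simp [Matrix.mulVec, dotProduct]

/-- If `V` is at most its own one-step value under the policy `q`, it is at most the cost of `q`. -/
theorem le_policyValue (hα : 0 < α) (hα1 : α < 1) {q : S → A} {V : S → ℝ}
    (h : ∀ s, V s ≤ D.actionValue α V s (q s)) (s : S) : V s ≤ D.policyValue q α s := by
  have := D.nonpos_of_le_expNext hα hα1 q (V := fun s => V s - D.policyValue q α s) (fun s => by
    rw [D.expNext_sub]
    have h1 := h s
    have h2 := D.policyValue_eq hα hα1 q s
    simp only [actionValue] at h1 h2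
    linarith) s
  linarith

theorem policyValue_le (hα : 0 < α) (hα1 : α < 1) {q : S → A} {V : S → ℝ}
    (h : ∀ s, D.actionValue α V s (q s) ≤ V s) (s : S) : D.policyValue q α s ≤ V s := by
  have := D.nonpos_of_le_expNext hα hα1 q (V := fun s => D.policyValue q α s - V s) (fun s => by
    rw [D.expNext_sub]
    have h1 := h s
    have h2 := D.policyValue_eq hα hα1 q s
    simp only [actionValue] at h1 h2
    linarith) s
  linarith

/-- The discounted Bellman equation is solved by the cost of a best stationary policy: a policy that
minimizes the sum of the costs over all initial states cannot be improved at any single state. -/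
theorem exists_isBellman [Finite A] [Nonempty A] (hα : 0 < α) (hα1 : α < 1) :
    ∃ V, D.IsBellman α 0 V := by
  obtain ⟨q, hq⟩ := Finite.exists_min fun q : S → A => ∑ s, D.policyValue q α s
  refine ⟨D.policyValue q α, fun s a => ?_, fun s => ⟨q s, ?_⟩⟩
  · rw [zero_add]
    by_contra! hlt
    -- switching to the action `a` at `s` alone would be an improvement
    have himp : ∀ t, D.actionValue α (D.policyValue q α) t (Function.update q s a t) ≤
        D.policyValue q α t := fun t => by
      rcases eq_or_ne t s with rfl | hts
      · simpa using hlt.le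
      · rw [Function.update_of_ne hts]
        exact (D.policyValue_eq hα hα1 q t).ge
    have hle := D.policyValue_le hα hα1 himp
    have hslt : D.policyValue (Function.update q s a) α s < D.policyValue q α s := by
      refine lt_of_le_of_lt ?_ hlt
      rw [D.policyValue_eq hα hα1, Function.update_self]
      have h3 : D.expNext (D.policyValue (Function.update q s a) α) s a ≤
          D.expNext (D.policyValue q α) s a :=
        Finset.sum_le_sum fun b _ => mul_le_mul_of_nonneg_left (hle _) (D.prob_nonneg b)
      simp only [actionValue]
      nlinarith
    exact absurd (hq (Function.update q s a))
      (not_le.2 (Finset.sum_lt_sum (fun t _ => hle t) ⟨s, Finset.mem_univ s, hslt⟩))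
  · rw [zero_add]
    exact D.policyValue_eq hα hα1 q s

end Policy

/-! ### The vanishing discount limit -/

section Limit

variable {V : ℝ → S → ℝ}

theorem IsBellman.abs_one_sub_mul_le [Finite S] [Nonempty S] {W : S → ℝ} (hα : 0 < α) (hα1 : α < 1)
    (hW : D.IsBellman α 0 W) {C : ℝ} (hC : ∀ s a, |D.cost s a| ≤ C) (s : S) :
    |(1 - α) * W s| ≤ C := by
  obtain ⟨t, ht⟩ := Finite.exists_max W
  obtain ⟨r, hr⟩ := Finite.exists_min W
  obtain ⟨a, -⟩ := hW.exists_eq t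
  obtain ⟨b, hb⟩ := hW.exists_eq r
  have h1 := hW.le t a
  have h2 : D.expNext W t a ≤ W t := D.expNext_le fun _ => ht _
  have h3 : W r ≤ D.expNext W r b := D.le_expNext fun _ => hr _
  have hC1 := (abs_le.1 (hC t a)).2
  have hC2 := (abs_le.1 (hC r b)).1
  simp only [actionValue] at h1 hb
  have hs1 := ht s
  have hs2 := hr s
  rw [abs_le]
  constructor <;> nlinarith

/-- If two initial states are merged after `n` steps by any common sequence of actions and noise,
then their discounted costs differ by at most `n` stages, uniformly in the discount factor. Here
`R k s t` says that `s` and `t` already agree to the extent reached after `k` common steps. -/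
theorem IsBellman.sub_le {W : S → ℝ} (hα : 0 < α) (hα1 : α < 1) (hW : D.IsBellman α 0 W)
    {C : ℝ} (hC : ∀ s a, |D.cost s a| ≤ C) {R : ℕ → S → S → Prop} {n : ℕ}
    (hstep : ∀ k s t a b, R k s t → R (k + 1) (D.next s a b) (D.next t a b))
    (hn : ∀ s t, R n s t → s = t) (j : ℕ) :
    ∀ k, k + j = n → ∀ s t, R k s t → W s - W t ≤ 2 * C * j := by
  induction j with
  | zero =>
    rintro k rfl s t h
    simp [hn s t h]
  | succ j ih =>
    intro k hk s t h
    obtain ⟨a, ha⟩ := hW.exists_eq t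
    have h1 := hW.le s a
    have h2 : D.expNext W s a - D.expNext W t a ≤ 2 * C * j := by
      rw [expNext, expNext, ← Finset.sum_sub_distrib]
      calc ∑ b, (D.prob b * W (D.next s a b) - D.prob b * W (D.next t a b))
          ≤ ∑ b, D.prob b * (2 * C * j) := Finset.sum_le_sum fun b _ => by
            rw [← mul_sub]
            exact mul_le_mul_of_nonneg_left (ih (k + 1) (by omega) _ _ (hstep k s t a b h))
              (D.prob_nonneg b)
        _ = 2 * C * j := by rw [← Finset.sum_mul, D.prob_sum, one_mul]
    have hC1 := abs_le.1 (hC s a)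
    have hC2 := abs_le.1 (hC t a)
    have hC0 : 0 ≤ C := (abs_nonneg _).trans (hC s a)
    have h3 : α * (D.expNext W s a - D.expNext W t a) ≤ 2 * C * j :=
      (mul_le_mul_of_nonneg_left h2 hα.le).trans
        (mul_le_of_le_one_left (by positivity) hα1.le)
    simp only [actionValue] at ha h1
    push_cast
    linarith

/-- The discounted cost from `s` is the minimum of finitely many rational functions of the discount
factor, one of which is eventually the smallest. -/
theorem rationalNearOne_of_isBellman [Finite S] [Finite A] [Nonempty A]
    (hV : ∀ α, 0 < α → α < 1 → D.IsBellman α 0 (V α)) (s : S) :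
    RationalNearOne fun α => V α s := by
  classical
  have := Fintype.ofFinite S
  obtain ⟨q, hq⟩ := RationalNearOne.exists_eventually_le
    fun q : S → A => D.rationalNearOne_policyValue q s
  refine (D.rationalNearOne_policyValue q s).congr ?_
  filter_upwards [hq, Ioo_mem_nhdsLT (zero_lt_one' ℝ)] with α hqα hα
  have hB := hV α hα.1 hα.2
  choose p hp using hB.exists_eq
  refine le_antisymm ((hqα p).trans ?_) ?_
  · exact D.policyValue_le hα.1 hα.2 (fun t => by rw [← hp t, zero_add]) s
  · exact D.le_policyValue hα.1 hα.2 (fun t => by simpa using hB.le t (q t)) s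

/-- Vanishing discount: the normalized discounted costs and the relative discounted costs converge,
and their limits solve the average-cost Bellman equation. -/
theorem exists_vanishing_discount [Finite S] [Nonempty S] [Finite A] [Nonempty A]
    (hV : ∀ α, 0 < α → α < 1 → D.IsBellman α 0 (V α)) {R : ℕ → S → S → Prop} {n : ℕ}
    (hstep : ∀ k s t a b, R k s t → R (k + 1) (D.next s a b) (D.next t a b))
    (h0 : ∀ s t, R 0 s t) (hn : ∀ s t, R n s t → s = t) :
    ∃ lam, (∀ s, Tendsto (fun α => (1 - α) * V α s) (𝓝[<] 1) (𝓝 lam)) ∧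
      ∀ o, ∃ h : S → ℝ, (∀ s, Tendsto (fun α => V α s - V α o) (𝓝[<] 1) (𝓝 (h s))) ∧
        D.IsBellman 1 lam h := by
  obtain ⟨p, hp⟩ := Finite.exists_max fun p : S × A => |D.cost p.1 p.2|
  set C := |D.cost p.1 p.2|
  have hC : ∀ s a, |D.cost s a| ≤ C := fun s a => hp (s, a)
  have hI : ∀ᶠ α : ℝ in 𝓝[<] 1, 0 < α ∧ α < 1 := Ioo_mem_nhdsLT (zero_lt_one' ℝ)
  have hdiff : ∀ o s, ∃ L, Tendsto (fun α => V α s - V α o) (𝓝[<] 1) (𝓝 L) := fun o s => by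
    refine ((D.rationalNearOne_of_isBellman hV s).sub
      (D.rationalNearOne_of_isBellman hV o)).exists_tendsto (K := 2 * C * n) ?_
    filter_upwards [hI] with α hα
    have hb := IsBellman.sub_le D hα.1 hα.2 (hV α hα.1 hα.2) hC hstep hn n 0 (zero_add n)
    rw [abs_le]
    have h1 := hb s o (h0 s o)
    have h2 := hb o s (h0 o s)
    constructor <;> linarith
  have hnorm : ∀ s, ∃ L, Tendsto (fun α => (1 - α) * V α s) (𝓝[<] 1) (𝓝 L) := fun s => by
    have h1 := (D.rationalNearOne_of_isBellman hV s).eval_mul (1 - Polynomial.X)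
    simp only [Polynomial.eval_sub, Polynomial.eval_one, Polynomial.eval_X] at h1
    refine h1.exists_tendsto (K := C) ?_
    filter_upwards [hI] with α hα
    exact IsBellman.abs_one_sub_mul_le D hα.1 hα.2 (hV α hα.1 hα.2) hC s
  have hid : Tendsto (fun α : ℝ => α) (𝓝[<] 1) (𝓝 1) := tendsto_id.mono_left nhdsWithin_le_nhds
  obtain ⟨o₀⟩ := ‹Nonempty S›
  obtain ⟨lam, hlam⟩ := hnorm o₀
  have hlam' : ∀ s, Tendsto (fun α => (1 - α) * V α s) (𝓝[<] 1) (𝓝 lam) := fun s => by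
    obtain ⟨L, hL⟩ := hdiff o₀ s
    have h2 := hlam.add ((hid.const_sub 1).mul hL)
    rw [sub_self, zero_mul, add_zero] at h2
    exact h2.congr fun α => by ring
  refine ⟨lam, hlam', fun o => ?_⟩
  choose h hh using hdiff o
  have hact : ∀ s a, Tendsto (fun α => D.actionValue α (fun t => V α t - V α o) s a) (𝓝[<] 1)
      (𝓝 (D.actionValue 1 h s a)) := fun s a =>
    tendsto_const_nhds.add (hid.mul (tendsto_finsetSum _ fun b _ => (hh _).const_mul _))
  have hlhs : ∀ s, Tendsto (fun α => (1 - α) * V α o + (V α s - V α o)) (𝓝[<] 1)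
      (𝓝 (lam + h s)) := fun s => (hlam' o).add (hh s)
  -- both sides of the discounted equation are shifted by `α * V α o`
  have hshift : ∀ α s a, D.actionValue α (fun t => V α t - V α o) s a =
      D.actionValue α (V α) s a - α * V α o := fun α s a => by
    have := D.expNext_sub (V α) (fun _ => V α o) s a
    rw [D.expNext_const] at this
    rw [actionValue, this, actionValue]
    ring
  refine ⟨h, hh, fun s a => ?_, fun s => ?_⟩
  · refine le_of_tendsto_of_tendsto (hlhs s) (hact s a) ?_
    filter_upwards [hI] with α hα
    have := (hV α hα.1 hα.2).le s a
    rw [hshift]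
    linarith
  · -- a minimizing action that recurs for discount factors arbitrarily close to `1`
    have hfr : ∃ a, ∃ᶠ α in 𝓝[<] (1 : ℝ), V α s = D.actionValue α (V α) s a := by
      rw [← frequently_exists]
      refine Eventually.frequently ?_
      filter_upwards [hI] with α hα
      simpa using (hV α hα.1 hα.2).exists_eq s
    obtain ⟨a, ha⟩ := hfr
    refine ⟨a, sub_eq_zero.1 ?_⟩
    refine isClosed_singleton.mem_of_frequently_of_tendsto (s := {(0 : ℝ)}) ?_
      ((hlhs s).sub (hact s a))
    refine ha.mono fun α hα => ?_
    rw [Set.mem_singleton_iff, hshift, ← hα]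
    ring

end Limit

end NoiseMDP

/-! ### Random variables with finitely many values -/

section FiniteValued

variable {Ω : Type*} [mΩ : MeasurableSpace Ω] {P : Measure Ω} [IsProbabilityMeasure P]
  {T : Type*} [Fintype T] [MeasurableSpace T] [DiscreteMeasurableSpace T]

theorem integrable_comp_of_finite {X : Ω → T} (hX : Measurable X) (φ : T → ℝ) :
    Integrable (fun ω => φ (X ω)) P := by
  have : IsProbabilityMeasure (P.map X) := Measure.isProbabilityMeasure_map hX.aemeasurable
  exact (Integrable.of_finite (μ := P.map X) (f := φ)).comp_measurable hX

theorem integral_comp_eq_sum {X : Ω → T} (hX : Measurable X) (φ : T → ℝ) :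
    ∫ ω, φ (X ω) ∂P = ∑ t, P.real {ω | X ω = t} * φ t := by
  have : IsProbabilityMeasure (P.map X) := Measure.isProbabilityMeasure_map hX.aemeasurable
  rw [← integral_map hX.aemeasurable (Measurable.of_discrete (f := φ)).aestronglyMeasurable,
    integral_fintype Integrable.of_finite]
  refine Finset.sum_congr rfl fun t _ => ?_
  rw [map_measureReal_apply hX (measurableSet_singleton t), smul_eq_mul]
  rfl

end FiniteValued

theorem abs_integral_comp_le {Ω : Type*} [MeasurableSpace Ω] {P : Measure Ω}
    [IsProbabilityMeasure P] {T : Type*} {φ : T → ℝ} {K : ℝ} (h : ∀ t, |φ t| ≤ K) (X : Ω → T) :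
    |∫ ω, φ (X ω) ∂P| ≤ K := by
  have := norm_integral_le_of_norm_le_const (μ := P) (f := fun ω => φ (X ω)) (C := K)
    (Eventually.of_forall fun ω => h _)
  simpa using this

theorem exists_abs_le {T : Type*} [Finite T] (φ : T → ℝ) : ∃ K, 0 ≤ K ∧ ∀ t, |φ t| ≤ K := by
  have := Fintype.ofFinite T
  exact ⟨∑ t, |φ t|, Finset.sum_nonneg fun _ _ => abs_nonneg _, fun t =>
    Finset.single_le_sum (f := fun t => |φ t|) (fun _ _ => abs_nonneg _) (Finset.mem_univ t)⟩

/-! ### Upper limits and averages of real sequences -/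

theorem le_limsup_of_le_of_tendsto {u v : ℕ → ℝ} {L K : ℝ} (hu : Tendsto u atTop (𝓝 L))
    (huv : ∀ᶠ n in atTop, u n ≤ v n) (hv : ∀ n, v n ≤ K) : L ≤ limsup v atTop := by
  rw [← hu.limsup_eq]
  exact limsup_le_limsup huv hu.isBoundedUnder_ge.isCoboundedUnder_le
    (isBoundedUnder_of ⟨K, hv⟩)

theorem tendsto_average {lam c : ℝ} {e : ℕ → ℝ} {B : ℝ} (he : ∀ n, |e n| ≤ B) :
    Tendsto (fun n : ℕ => (1 / (n : ℝ)) * (lam * n + c - e n)) atTop (𝓝 lam) := by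
  have h1 : Tendsto (fun n : ℕ => (1 / (n : ℝ)) * (c - e n)) atTop (𝓝 0) := by
    refine squeeze_zero_norm (a := fun n : ℕ => (1 / (n : ℝ)) * (|c| + B)) (fun n => ?_) ?_
    · rw [norm_mul, Real.norm_of_nonneg (by positivity)]
      exact mul_le_mul_of_nonneg_left ((norm_sub_le _ _).trans (add_le_add le_rfl (he n)))
        (by positivity)
    · simpa using tendsto_one_div_atTop_nhds_zero_nat.mul_const (|c| + B)
  have h2 := h1.const_add lam
  rw [add_zero] at h2
  refine h2.congr' ?_
  filter_upwards [eventually_ne_atTop 0] with n hn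
  field_simp
  ring

namespace MAFSystem

variable {Ω : Type*} [mΩ : MeasurableSpace Ω] {P : Measure Ω} {m : ℕ} (M : MAFSystem P m)

/-! ### The decision process of a status update system -/

theorem mem_states {s : Fin m → ℝ} : s ∈ M.states ↔ M.Reachable s :=
  M.finite_reachable.mem_toFinset

/-- The states of the decision process, as a type. -/
abbrev State : Type := {s : Fin m → ℝ // s ∈ M.states}

/-- The admissible waiting times, as a type. -/
abbrev Wait : Type := {z : ℝ // z ∈ M.waits}

/-- The possible service times, as a type. -/
abbrev Service : Type := {y : ℝ // y ∈ M.services}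

instance : Nonempty M.Wait := ⟨⟨0, M.zero_mem_waits⟩⟩

instance : Nonempty M.State := ⟨⟨_, M.mem_states.2 .init⟩⟩

/-- The state that follows `s` after the waiting time `z` and the service time `y`. -/
def nextS (s : M.State) (z : M.Wait) (y : M.Service) : M.State :=
  ⟨nextState s.1 z.1 y.1, M.mem_states.2 (.step (M.mem_states.1 s.2) z.2 y.2)⟩

/-- The service time of packet `i + 1`. -/
def service (i : ℕ) (ω : Ω) : M.Service := ⟨M.Y (i + 1) ω, M.Y_mem i ω⟩

theorem measurable_service_info (i : ℕ) : Measurable[M.info (i + 1)] (M.service i) :=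
  @Measurable.subtype_mk _ _ (M.info (i + 1)) _ _ _ (M.Y_adapted i) _

theorem measurable_service (i : ℕ) : Measurable (M.service i) :=
  (M.measurable_service_info i).mono (M.info.le _) le_rfl

theorem real_service_eq (i : ℕ) (y : M.Service) :
    P.real {ω | M.service i ω = y} = P.real {ω | M.service 0 ω = y} := by
  have h := (M.Y_ident i).measure_mem_eq (measurableSet_singleton y.1)
  simp only [measureReal_def, service, Subtype.ext_iff]
  exact congrArg ENNReal.toReal h

/-- The decision process of the system, driven by the service times. -/
def toNoiseMDP [IsProbabilityMeasure P] : NoiseMDP M.State M.Wait M.Service where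
  next := M.nextS
  prob y := P.real {ω | M.service 0 ω = y}
  prob_nonneg _ := measureReal_nonneg
  prob_sum := by
    have := integral_comp_eq_sum (P := P) (M.measurable_service 0) fun _ => 1
    simpa using this.symm
  cost s z := M.cost s.1 z.1

namespace Sampler

variable {M} (f : M.Sampler) (s : M.State)

/-- The waiting time after the delivery of packet `i`, as an element of `M.Wait`. -/
def wait (i : ℕ) (ω : Ω) : M.Wait := ⟨f.Z i ω, f.Z_mem i ω⟩

/-- The state process started in `s`, as a process in `M.State`. -/
def stateProc : ℕ → Ω → M.State
  | 0, _ => s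
  | i + 1, ω => M.nextS (stateProc i ω) (f.wait i ω) (M.service i ω)

theorem coe_stateProc (i : ℕ) (ω : Ω) : (f.stateProc s i ω : Fin m → ℝ) = M.state s.1 f i ω := by
  induction i with
  | zero => rfl
  | succ i ih => simp only [stateProc, state, nextS, wait, service, ih]

theorem measurable_wait_info (i : ℕ) : Measurable[M.info i] (f.wait i) :=
  @Measurable.subtype_mk _ _ (M.info i) _ _ _ (f.Z_adapted i) _

end Sampler

/-- A process that updates itself by `nextS`, with adapted waiting times, is adapted. -/
theorem measurable_info_of_step {X : ℕ → Ω → M.State} {A : ℕ → Ω → M.Wait} {s : M.State}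
    (h0 : ∀ ω, X 0 ω = s) (hX : ∀ i ω, X (i + 1) ω = M.nextS (X i ω) (A i ω) (M.service i ω))
    (hA : ∀ i, Measurable[M.info i] (X i) → Measurable[M.info i] (A i)) (i : ℕ) :
    Measurable[M.info i] (X i) := by
  induction i with
  | zero =>
    rw [show X 0 = fun _ => s from funext h0]
    exact @measurable_const _ _ _ (M.info 0) _
  | succ i ih =>
    have hle := M.info.mono (Nat.le_succ i)
    have h3 := (ih.mono hle le_rfl).prodMk
      (((hA i ih).mono hle le_rfl).prodMk (M.measurable_service_info i))
    rw [show X (i + 1) = (fun p : M.State × M.Wait × M.Service => M.nextS p.1 p.2.1 p.2.2) ∘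
      fun ω => (X i ω, A i ω, M.service i ω) from funext (hX i)]
    exact Measurable.of_discrete.comp h3

namespace Sampler

variable {M} (f : M.Sampler) (s : M.State)

theorem measurable_stateProc_info (i : ℕ) : Measurable[M.info i] (f.stateProc s i) :=
  M.measurable_info_of_step (fun _ => rfl) (fun _ _ => rfl)
    (fun i _ => f.measurable_wait_info i) i

theorem measurable_pair_info (i : ℕ) :
    Measurable[M.info i] fun ω => (f.stateProc s i ω, f.wait i ω) :=
  (f.measurable_stateProc_info s i).prodMk (f.measurable_wait_info i)

theorem measurable_pair (i : ℕ) : Measurable fun ω => (f.stateProc s i ω, f.wait i ω) :=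
  (f.measurable_pair_info s i).mono (M.info.le i) le_rfl

theorem measurable_stateProc (i : ℕ) : Measurable (f.stateProc s i) :=
  (f.measurable_stateProc_info s i).mono (M.info.le i) le_rfl

/-- A feedback rule is realized by a sampler: feeding the rule with its own state process gives an
adapted sequence of waiting times. -/
theorem exists_feedback (q : M.State → M.Wait) (s : M.State) :
    ∃ f : M.Sampler, ∀ i ω, f.wait i ω = q (f.stateProc s i ω) := by
  let X : ℕ → Ω → M.State := fun i =>
    Nat.rec (fun _ => s) (fun i x ω => M.nextS (x ω) (q (x ω)) (M.service i ω)) i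
  have hX : ∀ i, Measurable[M.info i] (X i) :=
    M.measurable_info_of_step (A := fun i ω => q (X i ω)) (fun _ => rfl) (fun _ _ => rfl)
      fun i h => Measurable.of_discrete.comp h
  let f : M.Sampler :=
    { Z := fun i ω => q (X i ω)
      Z_mem := fun i ω => (q (X i ω)).2
      Z_adapted := fun i =>
        (Measurable.of_discrete (f := fun x : M.State => (q x : ℝ))).comp (hX i) }
  have hf : ∀ i ω, f.stateProc s i ω = X i ω := fun i ω => by
    induction i with
    | zero => rfl
    | succ i ih =>
      change M.nextS (f.stateProc s i ω) (q (X i ω)) _ = M.nextS (X i ω) (q (X i ω)) _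
      rw [ih]
  exact ⟨f, fun i ω => by rw [hf]; rfl⟩

variable [IsProbabilityMeasure P]

/-- One step of the process: the next service time is independent of the current state and waiting
time, so that the next state is distributed according to the transition law. -/
theorem integral_stateProc_succ (V : M.State → ℝ) (i : ℕ) :
    ∫ ω, V (f.stateProc s (i + 1) ω) ∂P =
      ∫ ω, M.toNoiseMDP.expNext V (f.stateProc s i ω) (f.wait i ω) ∂P := by
  have hsplit : ∀ ω, V (f.stateProc s (i + 1) ω) = ∑ y, (if M.service i ω = y then (1 : ℝ) else 0) *
      V (M.nextS (f.stateProc s i ω) (f.wait i ω) y) := fun ω => by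
    simp [stateProc]
  have hV : ∀ y, Integrable (fun ω => V (M.nextS (f.stateProc s i ω) (f.wait i ω) y)) P :=
    fun y => integrable_comp_of_finite (f.measurable_pair s i) fun p => V (M.nextS p.1 p.2 y)
  have hI : ∀ y, Integrable (fun ω => if M.service i ω = y then (1 : ℝ) else 0) P :=
    fun y => integrable_comp_of_finite (M.measurable_service i)
      fun x => if x = y then (1 : ℝ) else 0
  have hind : ∀ y, IndepFun (fun ω => if M.service i ω = y then (1 : ℝ) else 0)
      (fun ω => V (M.nextS (f.stateProc s i ω) (f.wait i ω) y)) P := fun y => by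
    rw [IndepFun_iff_Indep]
    refine indep_of_indep_of_le_left (indep_of_indep_of_le_right (M.Y_indep i) ?_) ?_
    · exact Measurable.comap_le ((Measurable.of_discrete
        (f := fun p : M.State × M.Wait => V (M.nextS p.1 p.2 y))).comp (f.measurable_pair_info s i))
    · have : (fun ω => if M.service i ω = y then (1 : ℝ) else 0) =
          (fun x : ℝ => if x = y then (1 : ℝ) else 0) ∘ M.Y (i + 1) := by
        funext ω
        simp [service, Subtype.ext_iff]
      rw [this, ← MeasurableSpace.comap_comp]
      exact MeasurableSpace.comap_mono
        (Measurable.ite (measurableSet_singleton _) measurable_const measurable_const).comap_le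
  have hprod : ∀ y, Integrable (fun ω => (if M.service i ω = y then (1 : ℝ) else 0) *
      V (M.nextS (f.stateProc s i ω) (f.wait i ω) y)) P :=
    fun y => (hind y).integrable_mul (hI y) (hV y)
  simp only [hsplit, NoiseMDP.expNext, toNoiseMDP]
  rw [integral_finsetSum _ fun y _ => hprod y,
    integral_finsetSum _ fun y _ => (hV y).const_mul _]
  refine Finset.sum_congr rfl fun y _ => ?_
  rw [integral_const_mul, (hind y).integral_fun_mul_eq_mul_integral
    (hI y).aestronglyMeasurable (hV y).aestronglyMeasurable]
  congr 1
  rw [integral_comp_eq_sum (M.measurable_service i) fun x => if x = y then (1 : ℝ) else 0]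
  simp [M.real_service_eq i]

/-- The expected cost of stage `i` under the sampler `f` started in `s`. -/
def stageCost (i : ℕ) : ℝ :=
  ∫ ω, M.toNoiseMDP.cost (f.stateProc s i ω) (f.wait i ω) ∂P

theorem integral_sum_cost (w : ℕ → ℝ) (n : ℕ) :
    ∫ ω, ∑ i ∈ Finset.range n, w i * M.cost (M.state s.1 f i ω) (f.Z i ω) ∂P =
      ∑ i ∈ Finset.range n, w i * f.stageCost s i := by
  have h : ∀ i ω, M.cost (M.state s.1 f i ω) (f.Z i ω) =
      M.toNoiseMDP.cost (f.stateProc s i ω) (f.wait i ω) := fun i ω => by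
    rw [← coe_stateProc]
    rfl
  simp only [h]
  rw [integral_finsetSum _ fun i _ => (integrable_comp_of_finite (f.measurable_pair s i)
    fun p => M.toNoiseMDP.cost p.1 p.2).const_mul _]
  exact Finset.sum_congr rfl fun i _ => integral_const_mul _ _

theorem discCost_eq (α : ℝ) : M.discCost α s.1 f =
    limsup (fun n => ∑ i ∈ Finset.range n, α ^ i * f.stageCost s i) atTop := by
  simp only [discCost, f.integral_sum_cost s]

theorem avgCost_eq : M.avgCost s.1 f =
    limsup (fun n : ℕ => (1 / (n : ℝ)) * ∑ i ∈ Finset.range n, f.stageCost s i) atTop := by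
  have h := f.integral_sum_cost s fun _ => 1
  simp only [one_mul] at h
  simp only [avgCost, h]

theorem integral_actionValue (α : ℝ) (V : M.State → ℝ) (i : ℕ) :
    ∫ ω, M.toNoiseMDP.actionValue α V (f.stateProc s i ω) (f.wait i ω) ∂P =
      f.stageCost s i + α * ∫ ω, V (f.stateProc s (i + 1) ω) ∂P := by
  rw [f.integral_stateProc_succ s V i, stageCost, ← integral_const_mul]
  exact integral_add (integrable_comp_of_finite (f.measurable_pair s i)
    fun p => M.toNoiseMDP.cost p.1 p.2)
    ((integrable_comp_of_finite (f.measurable_pair s i)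
      fun p => M.toNoiseMDP.expNext V p.1 p.2).const_mul α)

theorem integral_const_add (lam : ℝ) (V : M.State → ℝ) (i : ℕ) :
    ∫ ω, (lam + V (f.stateProc s i ω)) ∂P = lam + ∫ ω, V (f.stateProc s i ω) ∂P := by
  rw [integral_add (integrable_const _) (integrable_comp_of_finite (f.measurable_stateProc s i) V)]
  simp

/-- Verification inequality: a subsolution of Bellman's equation bounds the cost of every sampler
from below. -/
theorem le_sum_stageCost {α lam : ℝ} (hα : 0 ≤ α) {V : M.State → ℝ}
    (hV : ∀ t a, lam + V t ≤ M.toNoiseMDP.actionValue α V t a) (n : ℕ) :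
    lam * ∑ i ∈ Finset.range n, α ^ i + V s ≤ ∑ i ∈ Finset.range n, α ^ i * f.stageCost s i +
      α ^ n * ∫ ω, V (f.stateProc s n ω) ∂P := by
  induction n with
  | zero => simp [stateProc]
  | succ n ih =>
    have h : lam + ∫ ω, V (f.stateProc s n ω) ∂P ≤
        f.stageCost s n + α * ∫ ω, V (f.stateProc s (n + 1) ω) ∂P := by
      rw [← f.integral_actionValue s, ← f.integral_const_add s]
      exact integral_mono (integrable_comp_of_finite (f.measurable_stateProc s n)
        fun t => lam + V t) (integrable_comp_of_finite (f.measurable_pair s n)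
        fun p => M.toNoiseMDP.actionValue α V p.1 p.2) fun ω => hV _ _
    have h2 := mul_le_mul_of_nonneg_left h (pow_nonneg hα n)
    rw [Finset.sum_range_succ, Finset.sum_range_succ, pow_succ]
    linarith

theorem sum_stageCost_eq {α lam : ℝ} {V : M.State → ℝ} {q : M.State → M.Wait}
    (hq : ∀ t, lam + V t = M.toNoiseMDP.actionValue α V t (q t))
    (hf : ∀ i ω, f.wait i ω = q (f.stateProc s i ω)) (n : ℕ) :
    lam * ∑ i ∈ Finset.range n, α ^ i + V s = ∑ i ∈ Finset.range n, α ^ i * f.stageCost s i +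
      α ^ n * ∫ ω, V (f.stateProc s n ω) ∂P := by
  induction n with
  | zero => simp [stateProc]
  | succ n ih =>
    have h : lam + ∫ ω, V (f.stateProc s n ω) ∂P =
        f.stageCost s n + α * ∫ ω, V (f.stateProc s (n + 1) ω) ∂P := by
      rw [← f.integral_actionValue s, ← f.integral_const_add s]
      simp only [hq, hf]
    rw [Finset.sum_range_succ, Finset.sum_range_succ, pow_succ]
    linear_combination ih + α ^ n * h

end Sampler

/-! ### Optimal samplers -/

variable [IsProbabilityMeasure P]

theorem exists_stageCost_bound : ∃ K, 0 ≤ K ∧ ∀ (f : M.Sampler) s i, |f.stageCost s i| ≤ K := by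
  obtain ⟨K, hK0, hK⟩ := exists_abs_le fun p : M.State × M.Wait => M.toNoiseMDP.cost p.1 p.2
  exact ⟨K, hK0, fun f s i => abs_integral_comp_le hK fun ω => (f.stateProc s i ω, f.wait i ω)⟩

/-- A solution of the discounted Bellman equation is the optimal discounted cost. -/
theorem isLeast_discCost {α : ℝ} (hα : 0 < α) (hα1 : α < 1) {V : M.State → ℝ}
    (hV : M.toNoiseMDP.IsBellman α 0 V) (s : M.State) :
    IsLeast (Set.range (M.discCost α s.1)) (V s) := by
  obtain ⟨B, -, hB⟩ := exists_abs_le V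
  obtain ⟨K, hK0, hK⟩ := M.exists_stageCost_bound
  -- the discounted value of the terminal state vanishes
  have hlim : ∀ f : M.Sampler, Tendsto (fun n => V s - α ^ n * ∫ ω, V (f.stateProc s n ω) ∂P)
      atTop (𝓝 (V s)) := fun f => by
    have h0 : Tendsto (fun n => α ^ n * ∫ ω, V (f.stateProc s n ω) ∂P) atTop (𝓝 0) := by
      refine squeeze_zero_norm (a := fun n => α ^ n * B) (fun n => ?_) ?_
      · rw [norm_mul, norm_pow, Real.norm_of_nonneg hα.le]
        exact mul_le_mul_of_nonneg_left (abs_integral_comp_le hB _) (by positivity)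
      · simpa using (tendsto_pow_atTop_nhds_zero_of_lt_one hα.le hα1).mul_const B
    simpa using h0.const_sub (V s)
  refine ⟨?_, ?_⟩
  · choose q hq using hV.exists_eq
    obtain ⟨f, hf⟩ := Sampler.exists_feedback q s
    refine ⟨f, ?_⟩
    rw [f.discCost_eq]
    refine ((hlim f).congr fun n => ?_).limsup_eq
    have := f.sum_stageCost_eq s hq hf n
    linarith
  · rintro _ ⟨f, rfl⟩
    rw [f.discCost_eq]
    refine le_limsup_of_le_of_tendsto (K := K * (1 - α)⁻¹) (hlim f)
      (Eventually.of_forall fun n => ?_) fun n => ?_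
    · have := f.le_sum_stageCost s hα.le hV.le n
      linarith
    · calc ∑ i ∈ Finset.range n, α ^ i * f.stageCost s i
          ≤ ∑ i ∈ Finset.range n, α ^ i * K := Finset.sum_le_sum fun i _ =>
            mul_le_mul_of_nonneg_left (abs_le.1 (hK f s i)).2 (by positivity)
        _ = K * ∑ i ∈ Finset.range n, α ^ i := by rw [← Finset.sum_mul, mul_comm]
        _ ≤ K * (1 - α)⁻¹ := by
            rw [← tsum_geometric_of_lt_one hα.le hα1]
            exact mul_le_mul_of_nonneg_left ((summable_geometric_of_lt_one hα.le hα1).sum_le_tsum _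
              fun i _ => by positivity) hK0

/-- A solution of the average-cost Bellman equation bounds all average costs from below. -/
theorem le_avgCost {lam : ℝ} {h : M.State → ℝ} (hB : M.toNoiseMDP.IsBellman 1 lam h)
    (s : M.State) (f : M.Sampler) : lam ≤ M.avgCost s.1 f := by
  obtain ⟨B, -, hB'⟩ := exists_abs_le h
  obtain ⟨K, hK0, hK⟩ := M.exists_stageCost_bound
  rw [f.avgCost_eq]
  refine le_limsup_of_le_of_tendsto (K := K) (tendsto_average (c := h s) (B := B)
    (e := fun n => ∫ ω, h (f.stateProc s n ω) ∂P) fun n => abs_integral_comp_le hB' _)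
    (Eventually.of_forall fun n => ?_) fun n => ?_
  · refine mul_le_mul_of_nonneg_left ?_ (by positivity)
    have := f.le_sum_stageCost s zero_le_one hB.le n
    simp only [one_pow, one_mul, Finset.sum_const, Finset.card_range, nsmul_eq_mul, mul_one] at this
    linarith
  · have h1 : ∑ i ∈ Finset.range n, f.stageCost s i ≤ n * K :=
      (Finset.sum_le_sum fun i _ => (abs_le.1 (hK f s i)).2).trans (by simp)
    rcases Nat.eq_zero_or_pos n with rfl | hn
    · simpa using hK0
    · have hn' : (0 : ℝ) < n := by exact_mod_cast hn
      rw [one_div, inv_mul_le_iff₀ hn']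
      exact h1

/-- Feedback by minimizers in the average-cost Bellman equation attains the optimal average. -/
theorem avgCost_eq_of_feedback {lam : ℝ} {h : M.State → ℝ} {q : M.State → M.Wait}
    (hq : ∀ t, lam + h t = M.toNoiseMDP.actionValue 1 h t (q t)) (s : M.State) (f : M.Sampler)
    (hf : ∀ i ω, f.wait i ω = q (f.stateProc s i ω)) : M.avgCost s.1 f = lam := by
  obtain ⟨B, -, hB'⟩ := exists_abs_le h
  rw [f.avgCost_eq]
  refine ((tendsto_average (lam := lam) (c := h s) (B := B)
    (e := fun n => ∫ ω, h (f.stateProc s n ω) ∂P)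
    fun n => abs_integral_comp_le hB' _).congr fun n => ?_).limsup_eq
  have := f.sum_stageCost_eq s hq hf n
  simp only [one_pow, one_mul, Finset.sum_const, Finset.card_range, nsmul_eq_mul, mul_one] at this
  rw [this]
  ring

/-! ### Bellman's equation in terms of transition probabilities -/

theorem bellmanRHS_eq (h : (Fin m → ℝ) → ℝ) (s : M.State) (z : M.Wait) :
    M.bellmanRHS h s.1 z.1 = M.toNoiseMDP.actionValue 1 (fun t => h t.1) s z := by
  have h1 := integral_comp_eq_sum (P := P) (X := fun ω => M.nextS s z (M.service 0 ω))
    ((Measurable.of_discrete (f := M.nextS s z)).comp (M.measurable_service 0)) fun t => h t.1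
  have h2 := integral_comp_eq_sum (P := P) (M.measurable_service 0)
    fun y => h (M.nextS s z y).1
  rw [bellmanRHS, NoiseMDP.actionValue, one_mul]
  congr 1
  refine Eq.trans ?_ (h1.symm.trans h2)
  rw [← Finset.sum_coe_sort M.states]
  refine Finset.sum_congr rfl fun t _ => ?_
  simp only [transProb, Subtype.ext_iff]
  rfl

end MAFSystem
end AgeSampling

end

/-! ### The vanishing discount theorem for the sampling problem -/

theorem proposition2 {Ω : Type*} [MeasurableSpace Ω] (P : Measure Ω) [IsProbabilityMeasure P]
    (m : ℕ) (M : AgeSampling.MAFSystem P m) :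
    -- the minimum that defines the optimal discounted cost is attained
    (∀ α : ℝ, 0 < α → α < 1 → ∀ s ∈ M.states,
      IsLeast (Set.range (M.discCost α s)) (M.optDiscCost α s)) ∧
    ∃ lam : ℝ,
      -- `lam` is the optimal average cost per stage from every initial state
      (∀ s ∈ M.states, IsLeast (Set.range (M.avgCost s)) lam) ∧
      (∀ s ∈ M.states,
        Tendsto (fun α : ℝ => (1 - α) * M.optDiscCost α s) (𝓝[<] 1) (𝓝 lam)) ∧
      -- for every reference state `o` there is a relative cost function `h`
      ∀ o ∈ M.states, ∃ h : (Fin m → ℝ) → ℝ,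
        (∀ s ∈ M.states,
          Tendsto (fun α : ℝ => M.optDiscCost α s - M.optDiscCost α o) (𝓝[<] 1) (𝓝 (h s))) ∧
        -- Bellman's equation
        (∀ s ∈ M.states,
          lam + h s = M.waits.inf' ⟨0, M.zero_mem_waits⟩ (M.bellmanRHS h s)) ∧
        -- a stationary deterministic policy that attains the minimum and is average-optimal
        ∃ q : (Fin m → ℝ) → ℝ, (∀ s, q s ∈ M.waits) ∧
          (∀ s ∈ M.states, IsMinOn (M.bellmanRHS h s) (M.waits : Set ℝ) (q s)) ∧
          (∀ s ∈ M.states, ∃ f : M.Sampler, M.IsStationary q s f ∧ M.IsAverageOptimal s f) := by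
  classical
  have hV : ∀ α, 0 < α → α < 1 → M.toNoiseMDP.IsBellman α 0 (fun s => M.optDiscCost α s.1) := by
    intro α hα hα1
    obtain ⟨V, hV⟩ := M.toNoiseMDP.exists_isBellman hα hα1
    have : (fun s : M.State => M.optDiscCost α s.1) = V :=
      funext fun s => (M.isLeast_discCost hα hα1 hV s).csInf_eq
    rwa [this]
  -- two states agree after `k` common steps in their `k` smallest ages
  obtain ⟨lam, hlam, hrel⟩ := M.toNoiseMDP.exists_vanishing_discount hV (n := m)
    (R := fun k s t => ∀ l : Fin m, m ≤ (l : ℕ) + k → s.1 l = t.1 l)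
    (fun k s t z y hst l hl => by
      by_cases h : (l : ℕ) + 1 < m
      · simp only [AgeSampling.MAFSystem.toNoiseMDP, AgeSampling.MAFSystem.nextS,
          AgeSampling.nextState, h, dite_true]
        rw [hst ⟨l + 1, h⟩ (by simpa using by omega)]
      · simp only [AgeSampling.MAFSystem.toNoiseMDP, AgeSampling.MAFSystem.nextS,
          AgeSampling.nextState, h, dite_false])
    (fun s t l hl => absurd l.2 (by omega))
    (fun s t hst => Subtype.ext (funext fun l => hst l (by omega)))
  refine ⟨fun α hα hα1 s hs => M.isLeast_discCost hα hα1 (hV α hα hα1) ⟨s, hs⟩, lam,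
    fun s hs => ?_, fun s hs => hlam ⟨s, hs⟩, fun o ho => ?_⟩
  · obtain ⟨h, -, hB⟩ := hrel ⟨s, hs⟩
    choose q hq using hB.exists_eq
    obtain ⟨f, hf⟩ := AgeSampling.MAFSystem.Sampler.exists_feedback q ⟨s, hs⟩
    refine ⟨⟨f, M.avgCost_eq_of_feedback hq ⟨s, hs⟩ f hf⟩, ?_⟩
    rintro _ ⟨f', rfl⟩
    exact M.le_avgCost hB ⟨s, hs⟩ f'
  · obtain ⟨h, hh, hB⟩ := hrel ⟨o, ho⟩
    choose q hq using hB.exists_eq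
    let h' : (Fin m → ℝ) → ℝ := fun s => if hs : s ∈ M.states then h ⟨s, hs⟩ else 0
    have hh' : (fun t : M.State => h' t.1) = h := funext fun t => dif_pos t.2
    have hrhs : ∀ s (hs : s ∈ M.states) z (hz : z ∈ M.waits),
        M.bellmanRHS h' s z = M.toNoiseMDP.actionValue 1 h ⟨s, hs⟩ ⟨z, hz⟩ := fun s hs z hz => by
      rw [← hh']
      exact M.bellmanRHS_eq h' ⟨s, hs⟩ ⟨z, hz⟩
    have hs' : ∀ s (hs : s ∈ M.states), h' s = h ⟨s, hs⟩ := fun s hs => dif_pos hs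
    have hqv : ∀ s (hs : s ∈ M.states), M.bellmanRHS h' s (q ⟨s, hs⟩) = lam + h' s := fun s hs => by
      rw [hrhs s hs _ (q ⟨s, hs⟩).2, hs' s hs, hq]
    have hle : ∀ s ∈ M.states, ∀ z ∈ M.waits, lam + h' s ≤ M.bellmanRHS h' s z :=
      fun s hs z hz => by
        rw [hrhs s hs z hz, hs' s hs]
        exact hB.le _ _
    refine ⟨h', fun s hs => ?_, fun s hs => ?_,
      fun s => if hs : s ∈ M.states then q ⟨s, hs⟩ else 0, fun s => ?_, fun s hs => ?_,
      fun s hs => ?_⟩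
    · rw [hs' s hs]
      exact hh ⟨s, hs⟩
    · refine le_antisymm (Finset.le_inf' _ _ (hle s hs)) ?_
      exact (Finset.inf'_le _ (q ⟨s, hs⟩).2).trans (hqv s hs).le
    · dsimp only
      split_ifs
      exacts [(q _).2, M.zero_mem_waits]
    · intro z hz
      simp only [hs, dite_true, Set.mem_ofPred_eq]
      rw [hqv s hs]
      exact hle s hs z hz
    · obtain ⟨f, hf⟩ := AgeSampling.MAFSystem.Sampler.exists_feedback q ⟨s, hs⟩
      refine ⟨f, fun i ω => ?_, fun f' => ?_⟩
      · dsimp only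
        rw [← f.coe_stateProc ⟨s, hs⟩ i ω, dif_pos (f.stateProc ⟨s, hs⟩ i ω).2]
        exact congrArg Subtype.val (hf i ω)
      · rw [M.avgCost_eq_of_feedback hq ⟨s, hs⟩ f hf]
        exact M.le_avgCost hB ⟨s, hs⟩ f'
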